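/- Let $\mathbb{K}$ be $\mathbb{R}$ or $\mathbb{C}$, let $H \neq \{0\}$ be a separable Hilbert space over $\mathbb{K}$, and let $A : \operatorname{dom}(A) \to H$ be a densely defined self-adjoint (possibly unbounded) linear operator on $H$. Then there exist a probability space $(\Omega, \mathcal{A}, \mu)$, a unitary operator $U : H \to L_2(\Omega, \mathcal{A}, \mu)$ (with $\mathbb{K}$-valued functions), and a measurable function $m : \Omega \to \mathbb{R}$ such that the induced real multiplication operator $T$ on $L_2(\Omega, \mathcal{A}, \mu)$, given by $Tf = mf$ on $\operatorname{dom}(T) = \{ f \in L_2(\Omega, \mathcal{A}, \mu) : mf \in L_2(\Omega, \mathcal{A}, \mu) \}$, satisfies $$U \circ A = T \circ U$$ as partially defined operators; that is, $\operatorname{dom}(A) = U^{-1}(\operatorname{dom}(T))$ and $U(Ax) = T(Ux)$ for all $x \in \operatorname{dom}(A)$. -/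

import Mathlib

open MeasureTheory
open scoped ENNReal

noncomputable section

/-- The composition `T ∘ U` of a partially defined operator `T` with an everywhere defined linear
map `U`, on its natural domain `U⁻¹(dom T)`. -/
def LinearPMap.compLinear {𝕜 E F G : Type*} [Ring 𝕜] [AddCommGroup E] [Module 𝕜 E]
    [AddCommGroup F] [Module 𝕜 F] [AddCommGroup G] [Module 𝕜 G]
    (T : F →ₗ.[𝕜] G) (U : E →ₗ[𝕜] F) : E →ₗ.[𝕜] G where
  domain := T.domain.comap U
  toFun :=
    { toFun := fun x => T ⟨U x, x.2⟩
      map_add' := fun x y => by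
        rw [← T.map_add]
        congr 1
        exact Subtype.ext (by simp)
      map_smul' := fun c x => by
        rw [RingHom.id_apply, ← T.map_smul]
        congr 1
        exact Subtype.ext (by simp) }

/-- The maximal domain `{f ∈ L₂ | m f ∈ L₂}` of multiplication by `m : Ω → ℝ` on `L₂(Ω, μ; 𝕜)`. -/
def realMulDomain (𝕜 : Type*) [RCLike 𝕜] {Ω : Type*} [MeasurableSpace Ω] (μ : Measure Ω)
    (m : Ω → ℝ) : Submodule 𝕜 (Lp 𝕜 2 μ) where
  carrier := {f | MemLp (fun ω => (m ω : 𝕜) * f ω) 2 μ}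
  zero_mem' := by
    refine (MemLp.zero (ε := 𝕜) (p := 2) (μ := μ)).ae_eq ?_
    filter_upwards [Lp.coeFn_zero 𝕜 2 μ] with ω h
    rw [h, Pi.zero_apply, mul_zero]
  add_mem' := fun {f g} hf hg => by
    refine (MemLp.add hf hg).ae_eq ?_
    filter_upwards [Lp.coeFn_add f g] with ω h
    rw [h, Pi.add_apply, Pi.add_apply, mul_add]
  smul_mem' := fun c f hf => by
    refine (MemLp.const_smul hf c).ae_eq ?_
    filter_upwards [Lp.coeFn_smul c f] with ω h
    simp only [Pi.smul_apply, smul_eq_mul, h]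
    ring

theorem realMul_toLp_add {𝕜 : Type*} [RCLike 𝕜] {Ω : Type*} [MeasurableSpace Ω] {μ : Measure Ω}
    {m : Ω → ℝ} (f g : Lp 𝕜 2 μ) (hf : MemLp (fun ω => (m ω : 𝕜) * f ω) 2 μ)
    (hg : MemLp (fun ω => (m ω : 𝕜) * g ω) 2 μ)
    (hfg : MemLp (fun ω => (m ω : 𝕜) * (f + g : Lp 𝕜 2 μ) ω) 2 μ) :
    hfg.toLp = hf.toLp + hg.toLp := by
  rw [← MemLp.toLp_add hf hg, MemLp.toLp_eq_toLp_iff]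
  filter_upwards [Lp.coeFn_add f g] with ω h
  rw [h, Pi.add_apply, Pi.add_apply, mul_add]

theorem realMul_toLp_smul {𝕜 : Type*} [RCLike 𝕜] {Ω : Type*} [MeasurableSpace Ω] {μ : Measure Ω}
    {m : Ω → ℝ} (c : 𝕜) (f : Lp 𝕜 2 μ) (hf : MemLp (fun ω => (m ω : 𝕜) * f ω) 2 μ)
    (hcf : MemLp (fun ω => (m ω : 𝕜) * (c • f : Lp 𝕜 2 μ) ω) 2 μ) :
    hcf.toLp = c • hf.toLp := by
  rw [← MemLp.toLp_const_smul c hf, MemLp.toLp_eq_toLp_iff]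
  filter_upwards [Lp.coeFn_smul c f] with ω h
  rw [h, Pi.smul_apply, Pi.smul_apply, smul_eq_mul, smul_eq_mul, mul_left_comm]

/-- The real multiplication operator `f ↦ m f` on `L₂(Ω, μ; 𝕜)` induced by `m : Ω → ℝ`, on its
maximal domain. -/
def realMulOperator (𝕜 : Type*) [RCLike 𝕜] {Ω : Type*} [MeasurableSpace Ω] (μ : Measure Ω)
    (m : Ω → ℝ) : Lp 𝕜 2 μ →ₗ.[𝕜] Lp 𝕜 2 μ where
  domain := realMulDomain 𝕜 μ m
  toFun :=
    { toFun := fun f => MemLp.toLp (fun ω => (m ω : 𝕜) * (f : Lp 𝕜 2 μ) ω) f.2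
      map_add' := fun f g => realMul_toLp_add f.1 g.1 f.2 g.2 (f + g).2
      map_smul' := fun c f => realMul_toLp_smul c f.1 f.2 (c • f).2 }

end

/-! The unbounded `A` is replaced by the bounded commuting self-adjoint operators `S = (1 + A²)⁻¹`
and `B = A S`, read off from the orthogonal projection onto the graph of `A`
(`IsSelfAdjoint.exists_bounded_pair`). They determine `A`, since `(x, y)` is in the graph iff `B x =
S y`; diagonalizing both at once therefore diagonalizes `A`, with multiplier "`B / S`".

The relation `S² + B² = S` is a circle of radius 1/2. With `T = 1/2 + B` it makes each of `S`, `1 -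
S`, `T`, `1 - T` a sum of two squares of self-adjoint operators, so all their Bernstein products are
positive (`re_inner_bernstein_nonneg`). The two-dimensional Hausdorff moment theorem
(`exists_measure_moments`) then gives each vector `v` a measure on the unit square whose moments are
`⟪v, S ^ k T ^ l v⟫`.

`H` splits into countably many cyclic subspaces (`exists_cyclic_decomposition`). The orbit vectors
`S ^ k T ^ l v_j` have the same Gram matrix as the monomials on disjoint copies of the square, and
both families are total; matching them gives the unitary (`exists_linearIsometryEquiv_of_inner_eq`).
The argument is the same over `ℝ` and `ℂ`. -/

/-! ### Bounded encoding of a self-adjoint operator -/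

section GraphProjection

variable {𝕜 : Type*} [RCLike 𝕜] {H : Type*} [NormedAddCommGroup H] [InnerProductSpace 𝕜 H]

local notation "⟪" x ", " y "⟫" => inner 𝕜 x y

/-- A subspace `G` of `H × H` which is symmetric as a linear relation contains `(a, b)` and
`(b, -a)` only if `a = b = 0`. -/
theorem eq_zero_of_mem_of_swap_neg_mem {G : Submodule 𝕜 (H × H)}
    (hG : ∀ p ∈ G, ∀ q ∈ G, ⟪p.2, q.1⟫ = ⟪p.1, q.2⟫) {a b : H} (h : (a, b) ∈ G)
    (h' : (b, -a) ∈ G) : a = 0 ∧ b = 0 := by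
  have key := hG _ h _ h'
  simp only [inner_neg_right, inner_self_eq_norm_sq_to_K] at key
  have key' : ‖b‖ ^ 2 = -‖a‖ ^ 2 := by exact_mod_cast key
  have ha : ‖a‖ = 0 := by nlinarith [sq_nonneg ‖a‖, sq_nonneg ‖b‖]
  have hb : ‖b‖ = 0 := by nlinarith [sq_nonneg ‖a‖, sq_nonneg ‖b‖]
  exact ⟨norm_eq_zero.1 ha, norm_eq_zero.1 hb⟩

/-- The first column `(S, B)` of the orthogonal projection onto the graph of a self-adjoint
operator `A`, that is `S = (1 + A²)⁻¹` and `B = A (1 + A²)⁻¹`. -/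
theorem IsSelfAdjoint.exists_graph_column [CompleteSpace H] {A : H →ₗ.[𝕜] H}
    (hA : IsSelfAdjoint A) :
    ∃ S B : H →L[𝕜] H, ∀ u, (S u, B u) ∈ A.graph ∧ (B u, u - S u) ∈ A.graph := by
  let e := WithLp.linearEquiv 2 𝕜 (H × H)
  let G : Submodule 𝕜 (WithLp 2 (H × H)) := A.graph.comap e.toLinearMap
  have hclosed : IsClosed (G : Set (WithLp 2 (H × H))) :=
    (hA.isClosed).preimage (WithLp.prod_continuous_ofLp 2 H H)
  have : CompleteSpace G := hclosed.completeSpace_coe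
  let i : H →L[𝕜] WithLp 2 (H × H) :=
    (WithLp.prodContinuousLinearEquiv 2 𝕜 H H).symm.toContinuousLinearMap ∘L
      ContinuousLinearMap.inl 𝕜 H H
  let P := (WithLp.prodContinuousLinearEquiv 2 𝕜 H H).toContinuousLinearMap ∘L G.starProjection ∘L i
  refine ⟨ContinuousLinearMap.fst 𝕜 H H ∘L P, ContinuousLinearMap.snd 𝕜 H H ∘L P, fun u => ?_⟩
  have h1 : G.starProjection (i u) ∈ G := Submodule.starProjection_apply_mem _ _
  refine ⟨h1, ?_⟩
  -- Orthogonality of `(u - S u, -B u)` to the graph says that `(B u, u - S u)` is in the graph of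
  -- the adjoint, which is `A`.
  have h2 : i u - G.starProjection (i u) ∈ Gᗮ := Submodule.sub_starProjection_mem_orthogonal _
  have hgr : A.graph = A.graph.adjoint := by
    conv_lhs => rw [← LinearPMap.isSelfAdjoint_def.1 hA]
    exact LinearPMap.adjoint_graph_eq_graph_adjoint hA.dense_domain
  rw [hgr, Submodule.mem_adjoint_iff]
  intro a b hab
  have h3 := (Submodule.mem_orthogonal _ _).1 h2 (WithLp.toLp 2 (a, b)) hab
  rw [WithLp.prod_inner_apply] at h3
  simp only [WithLp.ofLp_sub, Prod.fst_sub, Prod.snd_sub] at h3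
  change ⟪a, u - (P u).1⟫ + ⟪b, 0 - (P u).2⟫ = 0 at h3
  rw [zero_sub, inner_neg_right] at h3
  change ⟪b, (P u).2⟫ - ⟪a, u - (P u).1⟫ = 0
  linear_combination -h3

/-- Every self-adjoint operator `A` is encoded by the commuting bounded self-adjoint operators
`S = (1 + A²)⁻¹` and `B = A (1 + A²)⁻¹`. -/
theorem IsSelfAdjoint.exists_bounded_pair [CompleteSpace H] {A : H →ₗ.[𝕜] H}
    (hA : IsSelfAdjoint A) :
    ∃ S B : H →L[𝕜] H, (∀ x y, ⟪S x, y⟫ = ⟪x, S y⟫) ∧ (∀ x y, ⟪B x, y⟫ = ⟪x, B y⟫) ∧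
      S * B = B * S ∧ S * S + B * B = S ∧ (∀ x, S x = 0 → x = 0) ∧
      ∀ x y, (x, y) ∈ A.graph ↔ B x = S y := by
  obtain ⟨S, B, hSB⟩ := hA.exists_graph_column
  have h1 := fun u => (hSB u).1
  have h2 := fun u => (hSB u).2
  have hsymm : ∀ p ∈ A.graph, ∀ q ∈ A.graph, ⟪p.2, q.1⟫ = ⟪p.1, q.2⟫ := by
    rintro ⟨a, b⟩ hp q hq
    have hgr : A.graph = A.graph.adjoint := by
      conv_lhs => rw [← LinearPMap.isSelfAdjoint_def.1 hA]
      exact LinearPMap.adjoint_graph_eq_graph_adjoint hA.dense_domain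
    rw [hgr, Submodule.mem_adjoint_iff] at hq
    exact sub_eq_zero.1 (hq a b hp)
  -- Symmetry of `A` between `(S x, B x)` and `(B y, y - S y)`; the right-hand side makes `S`
  -- symmetric.
  have hS : ∀ x y, ⟪S x, y⟫ = ⟪S x, S y⟫ + ⟪B x, B y⟫ := fun x y => by
    have := hsymm _ (h1 x) _ (h2 y)
    simp only [inner_sub_right] at this
    linear_combination -this
  -- The differences `e1` and `-e2` have the form `(p, q)` and `(q, -p)`, so both vanish.
  -- Commutation and the circle relation are the case `(a, b) = (S u, B u)`.
  have hgraph : ∀ a b, (a, b) ∈ A.graph → S b = B a ∧ S a + B b = a := by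
    intro a b hab
    have e1 := A.graph.sub_mem (A.graph.add_mem (h1 a) (h2 b)) hab
    have e2 := A.graph.sub_mem (h1 b) (h2 a)
    have := eq_zero_of_mem_of_swap_neg_mem hsymm e1 (b := B a + (b - S b) - b) (by
      convert A.graph.neg_mem e2 using 1
      refine Prod.ext ?_ ?_ <;> simp <;> abel)
    simp only [] at this
    refine ⟨?_, sub_eq_zero.1 this.1⟩
    have h := this.2
    rw [← sub_eq_zero, ← neg_eq_zero, ← h]
    abel
  have hcomm : ∀ u, S (B u) = B (S u) := fun u => (hgraph _ _ (h1 u)).1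
  have hsq : ∀ u, S (S u) + B (B u) = S u := fun u => (hgraph _ _ (h1 u)).2
  have hinj : ∀ x, S x = 0 → x = 0 := by
    intro x hx
    have h := hS x x
    rw [hx, inner_zero_left, inner_zero_left, zero_add, eq_comm, inner_self_eq_zero] at h
    have h' := h2 x
    rw [h, hx, sub_zero] at h'
    exact A.graph_fst_eq_zero_snd h' rfl
  refine ⟨S, B, fun x y => ?_, fun x y => ?_, ?_, ?_, hinj, fun a b => ⟨fun h => ?_, fun h => ?_⟩⟩
  · rw [hS x y, ← inner_conj_symm x, hS y x, map_add, inner_conj_symm, inner_conj_symm]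
  · have e1 := hsymm _ (h1 x) _ (h1 y)
    have e2 := hsymm _ (h2 x) _ (h2 y)
    simp only [inner_sub_left, inner_sub_right] at e1 e2
    linear_combination e1 - e2
  · ext u; exact hcomm u
  · ext u; exact hsq u
  · exact (hgraph a b h).1.symm
  -- `S` is injective and sends both sides to `S a`; then `(a, b)` is the sum of the graph elements
  -- `(S a, B a)` and `(B b, b - S b)`.
  · have e : S a + B b = a := by
      rw [← sub_eq_zero]
      apply hinj
      rw [map_sub, map_add, hcomm, ← h, hsq, sub_self]
    have := A.graph.add_mem (h1 a) (h2 b)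
    rw [Prod.mk_add_mk, e, h, add_sub_cancel] at this
    exact this

end GraphProjection

/-! ### Hausdorff moment problem on the unit square -/

section Moments

open Finset Filter Topology unitInterval

/-- Factorial moments of the binomial weights: `C(i,k) C(N,i) = C(N,k) C(N-k,i-k)` leaves the
expansion of `(x + (1 - x)) ^ (N - k)`. They are exact at every `N`. -/
theorem sum_choose_mul_bernstein {R : Type*} [Ring R] (x : R) (N k : ℕ) :
    ∑ i ∈ range (N + 1), i.choose k • (N.choose i • (x ^ i * (1 - x) ^ (N - i))) =
      N.choose k • x ^ k := by
  rcases lt_or_ge N k with hNk | hNk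
  · rw [Nat.choose_eq_zero_of_lt hNk, zero_smul]
    refine sum_eq_zero fun i hi => ?_
    rw [Nat.choose_eq_zero_of_lt (by have := mem_range.1 hi; omega), zero_smul]
  obtain ⟨M, rfl⟩ := Nat.exists_eq_add_of_le hNk
  have hcomm : Commute x (1 - x) := (Commute.one_right x).sub_right (Commute.refl x)
  rw [add_assoc, sum_range_add, sum_eq_zero, zero_add]
  · have hone : ∑ j ∈ range (M + 1), x ^ j * (1 - x) ^ (M - j) * (M.choose j : R) = 1 := by
      rw [← hcomm.add_pow, add_sub_cancel, one_pow]
    calc _ = ∑ j ∈ range (M + 1),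
          (k + M).choose k • (x ^ k * (x ^ j * (1 - x) ^ (M - j) * (M.choose j : R))) := by
          refine sum_congr rfl fun j hj => ?_
          have hj' : j ≤ M := Nat.lt_succ_iff.1 (mem_range.1 hj)
          have hc := Nat.choose_mul (n := k + M) (k := k + j) (s := k) (by omega)
          rw [Nat.add_sub_cancel_left, Nat.add_sub_cancel_left] at hc
          rw [smul_smul, mul_comm, hc, mul_smul, show k + M - (k + j) = M - j by omega, pow_add,
            ← Nat.cast_comm, ← nsmul_eq_mul, mul_smul_comm, mul_assoc]
      _ = _ := by rw [← smul_sum, ← mul_sum, hone, mul_one]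
  · intro i hi
    rw [Nat.choose_eq_zero_of_lt (mem_range.1 hi), zero_smul]

theorem Nat.cast_choose_succ_eq (i k : ℕ) :
    ((i.choose (k + 1) : ℕ) : ℝ) * (k + 1) = i.choose k * ((i : ℝ) - k) := by
  have h := Nat.choose_succ_right_eq i k
  rcases le_or_gt k i with hk | hk
  · rw [← Nat.cast_sub hk]; exact_mod_cast h
  · rw [Nat.choose_eq_zero_of_lt hk, Nat.choose_eq_zero_of_lt (by omega)]; simp

/-- Passes from factorial moments to power moments, with an error uniform in `i`. The ratio is a
product of factors `(i - j) / (N - j)`, each close to `i / N`; `2 * k ≤ N` keeps the denominators at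
least `N / 2`. -/
theorem abs_choose_div_choose_sub_pow_le (k : ℕ) : ∃ C : ℝ, ∀ N : ℕ, 1 ≤ N → 2 * k ≤ N →
    ∀ i ≤ N, |(i.choose k : ℝ) / N.choose k - ((i : ℝ) / N) ^ k| ≤ C / N := by
  induction k with
  | zero => exact ⟨0, fun N _ _ i _ => by simp⟩
  | succ k ih =>
    obtain ⟨C, hC⟩ := ih
    refine ⟨C + 2 * k, fun N hN hkN i hi => ?_⟩
    have h1 := hC N hN (by omega) i hi
    have hN' : (0 : ℝ) < N := by exact_mod_cast hN
    have hi' : (i : ℝ) ≤ N := by exact_mod_cast hi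
    have hk : (2 * (k + 1) : ℝ) ≤ N := by exact_mod_cast hkN
    have hk0 : (0 : ℝ) ≤ k := Nat.cast_nonneg k
    have hi0 : (0 : ℝ) ≤ i := Nat.cast_nonneg i
    have hNk : (0 : ℝ) < N - k := by linarith
    have hpos : (0 : ℝ) < N.choose k := by exact_mod_cast Nat.choose_pos (by omega)
    have hpos' : (0 : ℝ) < N.choose (k + 1) := by exact_mod_cast Nat.choose_pos (by omega)
    have hr : (i.choose (k + 1) : ℝ) / N.choose (k + 1) =
        (i.choose k : ℝ) / N.choose k * (((i : ℝ) - k) / (N - k)) := by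
      rw [div_mul_div_comm, div_eq_div_iff hpos'.ne' (mul_pos hpos hNk).ne',
        ← Nat.cast_choose_succ_eq N k, ← Nat.cast_choose_succ_eq i k]
      ring
    have hr1 : |(i.choose k : ℝ) / N.choose k| ≤ 1 := by
      rw [abs_of_nonneg (by positivity), div_le_one hpos]
      exact_mod_cast Nat.choose_le_choose k hi
    have hu1 : |(i : ℝ) / N| ≤ 1 := by
      rw [abs_of_nonneg (by positivity), div_le_one hN']; exact hi'
    have hd : |((i : ℝ) - k) / (N - k) - i / N| ≤ 2 * k / N := by
      have : ((i : ℝ) - k) / (N - k) - i / N = -(k * (N - i) / ((N - k) * N)) := by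
        field_simp; ring
      rw [this, abs_neg, abs_of_nonneg (by
        have : (0 : ℝ) ≤ N - i := by linarith
        positivity), div_le_div_iff₀ (by positivity) hN']
      have : (N - i : ℝ) ≤ 2 * (N - k) := by linarith
      nlinarith [mul_le_mul_of_nonneg_left this (mul_nonneg hk0 hN'.le)]
    calc _ = |((i.choose k : ℝ) / N.choose k - ((i : ℝ) / N) ^ k) * (i / N) +
          (i.choose k : ℝ) / N.choose k * (((i : ℝ) - k) / (N - k) - i / N)| := by
          rw [hr]; congr 1; ring
      _ ≤ C / N * 1 + 1 * (2 * k / N) := by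
          refine (abs_add_le _ _).trans ?_
          rw [abs_mul, abs_mul]
          have := (abs_nonneg _).trans h1
          gcongr
      _ = _ := by ring

/-- The point `(i / N, j / N)` of the unit square. -/
noncomputable def gridPoint (N : ℕ) (p : ℕ × ℕ) : I × I :=
  (Set.projIcc 0 1 zero_le_one ((p.1 : ℝ) / N), Set.projIcc 0 1 zero_le_one ((p.2 : ℝ) / N))

theorem coe_projIcc_div {i N : ℕ} (h : i ≤ N) :
    (Set.projIcc (0 : ℝ) 1 zero_le_one ((i : ℝ) / N) : ℝ) = i / N := by
  rw [Set.projIcc_of_mem zero_le_one ⟨by positivity,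
    div_le_one_of_le₀ (by exact_mod_cast h) (Nat.cast_nonneg _)⟩]

/-- The square grid `{0, …, N} × {0, …, N}`. -/
def squareGrid (N : ℕ) : Finset (ℕ × ℕ) := range (N + 1) ×ˢ range (N + 1)

/-- A probability vector on the grid `{0, …, N}²`, viewed as a measure on the unit square. -/
noncomputable def gridMeasure (N : ℕ) (w : ℕ × ℕ → ℝ) : Measure (I × I) :=
  ∑ p ∈ squareGrid N, ENNReal.ofReal (w p) • Measure.dirac (gridPoint N p)

theorem isProbabilityMeasure_gridMeasure {N : ℕ} {w : ℕ × ℕ → ℝ} (hw : ∀ p, 0 ≤ w p)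
    (hsum : ∑ p ∈ squareGrid N, w p = 1) : IsProbabilityMeasure (gridMeasure N w) := by
  constructor
  rw [gridMeasure, Measure.finsetSum_apply]
  simp only [Measure.smul_apply, measure_univ, smul_eq_mul, mul_one]
  rw [← ENNReal.ofReal_sum_of_nonneg fun p _ => hw p, hsum, ENNReal.ofReal_one]

theorem integral_gridMeasure {N : ℕ} {w : ℕ × ℕ → ℝ} (hw : ∀ p, 0 ≤ w p) (f : C(I × I, ℝ)) :
    ∫ x, f x ∂gridMeasure N w = ∑ p ∈ squareGrid N, w p * f (gridPoint N p) := by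
  rw [gridMeasure, integral_finsetSum_measure]
  · refine sum_congr rfl fun p _ => ?_
    rw [integral_smul_measure, integral_dirac, ENNReal.toReal_ofReal (hw p), smul_eq_mul]
  · intro p _
    exact (integrable_dirac (by simp)).smul_measure ENNReal.ofReal_ne_top

/-- The two-dimensional Hausdorff moment theorem, for the moments `φ (s ^ k * t ^ l)`. -/
theorem exists_measure_moments {R : Type*} [Ring R] (φ : R →+ ℝ) (hφ : φ 1 = 1) (s t : R)
    (hpos : ∀ a b c d : ℕ, 0 ≤ φ (s ^ a * (1 - s) ^ b * (t ^ c * (1 - t) ^ d))) :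
    ∃ μ : ProbabilityMeasure (I × I), ∀ k l : ℕ,
      ∫ p, (p.1 : ℝ) ^ k * (p.2 : ℝ) ^ l ∂(μ : Measure (I × I)) = φ (s ^ k * t ^ l) := by
  -- Bernstein weights: `hpos` makes them nonnegative, and they sum to `φ 1 = 1`.
  let w : ℕ → ℕ × ℕ → ℝ := fun N p =>
    φ ((N.choose p.1 • (s ^ p.1 * (1 - s) ^ (N - p.1))) *
      (N.choose p.2 • (t ^ p.2 * (1 - t) ^ (N - p.2))))
  have hw : ∀ N p, 0 ≤ w N p := fun N p => by
    simp only [w]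
    rw [smul_mul_smul_comm, map_nsmul]
    exact nsmul_nonneg (hpos _ _ _ _) _
  have hmom : ∀ N k l, ∑ p ∈ squareGrid N, w N p * ((p.1.choose k : ℝ) * (p.2.choose l : ℝ)) =
      (N.choose k : ℝ) * (N.choose l : ℝ) * φ (s ^ k * t ^ l) := by
    intro N k l
    have h1 : φ ((N.choose k • s ^ k) * (N.choose l • t ^ l)) =
        (N.choose k : ℝ) * (N.choose l : ℝ) * φ (s ^ k * t ^ l) := by
      rw [smul_mul_smul_comm, map_nsmul, nsmul_eq_mul, Nat.cast_mul]
    rw [← h1, ← sum_choose_mul_bernstein s N k, ← sum_choose_mul_bernstein t N l, sum_mul_sum,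
      map_sum, squareGrid, sum_product]
    refine sum_congr rfl fun i _ => ?_
    rw [map_sum]
    refine sum_congr rfl fun j _ => ?_
    rw [smul_mul_smul_comm, map_nsmul, nsmul_eq_mul, Nat.cast_mul, mul_comm]
  have hsum : ∀ N, ∑ p ∈ squareGrid N, w N p = 1 := fun N => by
    have := hmom N 0 0
    simpa [hφ] using this
  let μ : ℕ → ProbabilityMeasure (I × I) := fun N =>
    ⟨gridMeasure N (w N), isProbabilityMeasure_gridMeasure (hw N) (hsum N)⟩
  have hlim : ∀ k l : ℕ, Tendsto (fun N => ∫ p, (p.1 : ℝ) ^ k * (p.2 : ℝ) ^ l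
      ∂(μ N : Measure (I × I))) atTop (𝓝 (φ (s ^ k * t ^ l))) := by
    intro k l
    obtain ⟨C, hC⟩ := abs_choose_div_choose_sub_pow_le k
    obtain ⟨D, hD⟩ := abs_choose_div_choose_sub_pow_le l
    rw [tendsto_iff_norm_sub_tendsto_zero]
    refine squeeze_zero' (Eventually.of_forall fun _ => norm_nonneg _) ?_
      (tendsto_const_div_atTop_nhds_zero_nat (C + D))
    filter_upwards [eventually_ge_atTop (2 * k + 2 * l + 1)] with N hN
    have hk : (N.choose k : ℝ) ≠ 0 := by
      exact_mod_cast (Nat.choose_pos (show k ≤ N by omega)).ne'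
    have hl : (N.choose l : ℝ) ≠ 0 := by
      exact_mod_cast (Nat.choose_pos (show l ≤ N by omega)).ne'
    have e1 : φ (s ^ k * t ^ l) = ∑ p ∈ squareGrid N,
        w N p * ((p.1.choose k : ℝ) / N.choose k * ((p.2.choose l : ℝ) / N.choose l)) := by
      have : φ (s ^ k * t ^ l) = (∑ p ∈ squareGrid N,
          w N p * ((p.1.choose k : ℝ) * (p.2.choose l : ℝ))) / (N.choose k * N.choose l) := by
        rw [hmom]; field_simp
      rw [this, sum_div]
      refine sum_congr rfl fun p _ => ?_
      field_simp
    have e2 : ∫ p, (p.1 : ℝ) ^ k * (p.2 : ℝ) ^ l ∂(μ N : Measure (I × I)) =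
        ∑ p ∈ squareGrid N, w N p * (((p.1 : ℝ) / N) ^ k * ((p.2 : ℝ) / N) ^ l) := by
      refine (integral_gridMeasure (hw N)
        ⟨fun p : I × I => (p.1 : ℝ) ^ k * (p.2 : ℝ) ^ l, by fun_prop⟩).trans ?_
      refine sum_congr rfl fun p hp => ?_
      rw [squareGrid, mem_product, mem_range, mem_range] at hp
      simp only [gridPoint, ContinuousMap.coe_mk]
      rw [coe_projIcc_div (by omega), coe_projIcc_div (by omega)]
    rw [e1, e2, ← sum_sub_distrib, Real.norm_eq_abs]
    calc _ ≤ ∑ p ∈ squareGrid N, w N p * ((C + D) / N) := by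
          refine (abs_sum_le_sum_abs _ _).trans (sum_le_sum fun p hp => ?_)
          rw [← mul_sub, abs_mul, abs_of_nonneg (hw N p)]
          refine mul_le_mul_of_nonneg_left ?_ (hw N p)
          rw [squareGrid, mem_product, mem_range, mem_range] at hp
          have h1 := hC N (by omega) (by omega) p.1 (by omega)
          have h2 := hD N (by omega) (by omega) p.2 (by omega)
          have hr1 : |(p.2.choose l : ℝ) / N.choose l| ≤ 1 := by
            rw [abs_of_nonneg (by positivity)]
            refine div_le_one_of_le₀ ?_ (by positivity)
            exact_mod_cast Nat.choose_le_choose l (by omega)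
          have hu1 : |((p.1 : ℝ) / N) ^ k| ≤ 1 := by
            rw [abs_of_nonneg (by positivity)]
            refine pow_le_one₀ (by positivity) (div_le_one_of_le₀ ?_ (by positivity))
            exact_mod_cast (show p.1 ≤ N by omega)
          rw [abs_sub_comm, show (C + D) / (N : ℝ) = C / N * 1 + 1 * (D / N) by ring]
          have h1' := (abs_nonneg _).trans h1
          have h2' := (abs_nonneg _).trans h2
          calc _ = |((p.1.choose k : ℝ) / N.choose k - ((p.1 : ℝ) / N) ^ k) *
                ((p.2.choose l : ℝ) / N.choose l) + ((p.1 : ℝ) / N) ^ k *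
                ((p.2.choose l : ℝ) / N.choose l - ((p.2 : ℝ) / N) ^ l)| := by congr 1; ring
            _ ≤ _ := by
              refine (abs_add_le _ _).trans ?_
              rw [abs_mul, abs_mul]
              gcongr
      _ = (C + D) / N := by rw [← sum_mul, hsum, one_mul]
  -- Probability measures on the compact square form a compact space, so a limit along an
  -- ultrafilter replaces the choice of a convergent subsequence.
  have hne : ((hyperfilter ℕ).map μ : Filter (ProbabilityMeasure (I × I))) ≤
    𝓝 ((hyperfilter ℕ).map μ).lim := Ultrafilter.le_nhds_lim _
  refine ⟨((hyperfilter ℕ).map μ).lim, fun k l => ?_⟩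
  have h1 := (ProbabilityMeasure.tendsto_iff_forall_integral_tendsto.1
    (show Tendsto μ (hyperfilter ℕ) (𝓝 ((hyperfilter ℕ).map μ).lim) from hne))
    (BoundedContinuousFunction.mkOfCompact
      ⟨fun p : I × I => (p.1 : ℝ) ^ k * (p.2 : ℝ) ^ l, by fun_prop⟩)
  have h2 := (hlim k l).mono_left Nat.hyperfilter_le_atTop
  exact tendsto_nhds_unique h1 h2

end Moments

/-! ### Positivity of the Bernstein products -/

section Positivity

variable {𝕜 : Type*} [RCLike 𝕜] {H : Type*} [NormedAddCommGroup H] [InnerProductSpace 𝕜 H]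

local notation "⟪" x ", " y "⟫" => inner 𝕜 x y

/-- `⟪x, P C² x⟫ = ⟪C x, P (C x)⟫`, and likewise for `D`. Positivity thus survives multiplication by
a sum of two squares, with no operator square roots. -/
theorem re_inner_mul_sq_add_sq_nonneg {P C D : H →L[𝕜] H} (hP : ∀ x, 0 ≤ RCLike.re ⟪x, P x⟫)
    (hC : ∀ x y, ⟪C x, y⟫ = ⟪x, C y⟫) (hD : ∀ x y, ⟪D x, y⟫ = ⟪x, D y⟫) (hPC : Commute P C)
    (hPD : Commute P D) (x : H) : 0 ≤ RCLike.re ⟪x, (P * (C * C + D * D)) x⟫ := by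
  have h : P * (C * C + D * D) = C * (P * C) + D * (P * D) := by
    rw [mul_add, ← mul_assoc, ← mul_assoc, hPC.eq, hPD.eq, mul_assoc, mul_assoc, hPC.eq, hPD.eq]
  rw [h, _root_.add_apply, inner_add_right, map_add]
  change 0 ≤ RCLike.re ⟪x, C (P (C x))⟫ + RCLike.re ⟪x, D (P (D x))⟫
  rw [← hC, ← hD]
  exact add_nonneg (hP _) (hP _)

/-- For commuting self-adjoint `S`, `B` with `S² + B² = S` (the relation of a circle), all the
Bernstein products in `S` and `T = 1 / 2 + B` are positive. -/
theorem re_inner_bernstein_nonneg {S B T : H →L[𝕜] H} (hS : ∀ x y, ⟪S x, y⟫ = ⟪x, S y⟫)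
    (hB : ∀ x y, ⟪B x, y⟫ = ⟪x, B y⟫) (hcomm : S * B = B * S) (hsq : S * S + B * B = S)
    (hT : T = (2⁻¹ : 𝕜) • 1 + B) (a b c d : ℕ) (x : H) :
    0 ≤ RCLike.re ⟪x, (S ^ a * (1 - S) ^ b * (T ^ c * (1 - T) ^ d)) x⟫ := by
  let E : H →L[𝕜] H := (2⁻¹ : 𝕜) • 1 - S
  have hconj : starRingEnd 𝕜 2 = 2 := map_ofNat _ 2
  have hT' : ∀ x y, ⟪T x, y⟫ = ⟪x, T y⟫ := fun x y => by
    simp [hT, inner_add_left, inner_add_right, inner_smul_left, inner_smul_right, hB, hconj]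
  have hT'' : ∀ x y, ⟪(1 - T) x, y⟫ = ⟪x, (1 - T) y⟫ := fun x y => by
    simp [inner_sub_left, inner_sub_right, hT']
  have hS' : ∀ x y, ⟪(1 - S) x, y⟫ = ⟪x, (1 - S) y⟫ := fun x y => by
    simp [inner_sub_left, inner_sub_right, hS]
  have hE : ∀ x y, ⟪E x, y⟫ = ⟪x, E y⟫ := fun x y => by
    simp [E, inner_sub_left, inner_sub_right, inner_smul_left, inner_smul_right, hS, hconj]
  have hBB : B * B = S - S * S := by rw [eq_sub_iff_add_eq, add_comm, hsq]
  have h4 : (2⁻¹ : 𝕜) * 2⁻¹ + 2⁻¹ * 2⁻¹ = 2⁻¹ := by norm_num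
  have e1 : (1 - S) = (1 - S) * (1 - S) + B * B := by rw [hBB]; noncomm_ring
  have e2 : T = T * T + E * E := by
    simp only [hT, E, add_mul, mul_add, sub_mul, mul_sub, smul_mul_assoc, mul_smul_comm, one_mul,
      mul_one, hBB]
    match_scalars <;> linear_combination -h4
  have e3 : 1 - T = (1 - T) * (1 - T) + E * E := by
    simp only [hT, E, add_mul, mul_add, sub_mul, mul_sub, smul_mul_assoc, mul_smul_comm, one_mul,
      mul_one, hBB]
    match_scalars <;> linear_combination -h4
  have comm1 : ∀ P : H →L[𝕜] H, Commute P B → Commute P T := fun P h => by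
    rw [hT]; exact ((Commute.one_right P).smul_right _).add_right h
  have comm2 : ∀ P : H →L[𝕜] H, Commute P S → Commute P E := fun P h =>
    ((Commute.one_right P).smul_right _).sub_right h
  have comm3 : ∀ P Q : H →L[𝕜] H, Commute P Q → Commute P (1 - Q) := fun P Q h =>
    (Commute.one_right P).sub_right h
  -- Commutation with `S` and `B` is carried along with positivity so that the four kinds of factor
  -- can be multiplied on one at a time.
  let good : (H →L[𝕜] H) → Prop := fun P => Commute P S ∧ Commute P B ∧
    ∀ x, 0 ≤ RCLike.re ⟪x, P x⟫
  have step : ∀ R C D : H →L[𝕜] H, R = C * C + D * D → (∀ x y, ⟪C x, y⟫ = ⟪x, C y⟫) →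
      (∀ x y, ⟪D x, y⟫ = ⟪x, D y⟫) → (∀ P, Commute P S → Commute P B → Commute P C) →
      (∀ P, Commute P S → Commute P B → Commute P D) →
      ∀ P n, good P → good (P * R ^ n) := by
    intro R C D hR hC hD hC' hD' P n hP
    have hRS : Commute R S := by
      have h1 := hC' S (Commute.refl S) hcomm
      have h2 := hD' S (Commute.refl S) hcomm
      rw [hR]; exact ((h1.mul_right h1).add_right (h2.mul_right h2)).symm
    have hRB : Commute R B := by
      have h1 := hC' B hcomm.symm (Commute.refl B)
      have h2 := hD' B hcomm.symm (Commute.refl B)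
      rw [hR]; exact ((h1.mul_right h1).add_right (h2.mul_right h2)).symm
    induction n with
    | zero => simpa using hP
    | succ n ih =>
      rw [pow_succ, ← mul_assoc]
      refine ⟨ih.1.mul_left hRS, ih.2.1.mul_left hRB, fun x => ?_⟩
      have := re_inner_mul_sq_add_sq_nonneg ih.2.2 hC hD (hC' _ ih.1 ih.2.1) (hD' _ ih.1 ih.2.1) x
      rwa [← hR] at this
  have g0 : good 1 := ⟨Commute.one_left S, Commute.one_left B, fun x => by
    rw [one_apply_eq_self]; exact inner_self_nonneg⟩
  have g1 := step S S B hsq.symm hS hB (fun _ h _ => h) (fun _ _ h => h) _ a g0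
  have g2 := step (1 - S) (1 - S) B e1 hS' hB (fun _ h _ => comm3 _ _ h) (fun _ _ h => h) _ b g1
  have g3 := step T T E e2 hT' hE (fun _ _ h => comm1 _ h) (fun _ h _ => comm2 _ h) _ c g2
  have g4 := step (1 - T) (1 - T) E e3 hT'' hE (fun _ _ h => comm3 _ _ (comm1 _ h))
    (fun _ h _ => comm2 _ h) _ d g3
  rw [one_mul, mul_assoc (S ^ a * (1 - S) ^ b)] at g4
  exact g4.2.2 x

end Positivity

/-! ### Unitaries from equal Gram matrices -/

section TotalFamilies

variable {𝕜 : Type*} [RCLike 𝕜] {E F : Type*} [NormedAddCommGroup E] [InnerProductSpace 𝕜 E]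
  [NormedAddCommGroup F] [InnerProductSpace 𝕜 F]

local notation "⟪" x ", " y "⟫" => inner 𝕜 x y

theorem dense_span_range_of_inner_eq_zero [CompleteSpace E] {ι : Type*} {b : ι → E}
    (hb : ∀ u, (∀ i, ⟪b i, u⟫ = 0) → u = 0) :
    Dense (Submodule.span 𝕜 (Set.range b) : Set E) := by
  rw [Submodule.dense_iff_topologicalClosure_eq_top, Submodule.topologicalClosure_eq_top_iff,
    Submodule.eq_bot_iff]
  intro u hu
  exact hb u fun i => (Submodule.mem_orthogonal _ _).1 hu _ (Submodule.subset_span ⟨i, rfl⟩)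

theorem inner_linearCombination_eq {ι : Type*} {b : ι → E} {a : ι → F}
    (h : ∀ i j, ⟪b i, b j⟫ = ⟪a i, a j⟫) (p q : ι →₀ 𝕜) :
    ⟪Finsupp.linearCombination 𝕜 b p, Finsupp.linearCombination 𝕜 b q⟫ =
      ⟪Finsupp.linearCombination 𝕜 a p, Finsupp.linearCombination 𝕜 a q⟫ := by
  induction p using Finsupp.induction_linear with
  | zero => simp
  | add f g hf hg => simp only [map_add, inner_add_left, hf, hg]
  | single i c =>
    induction q using Finsupp.induction_linear with
    | zero => simp
    | add f g hf hg => simp only [map_add, inner_add_right, hf, hg]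
    | single j d =>
      simp only [Finsupp.linearCombination_single, inner_smul_left, inner_smul_right, h]

/-- Two total families with the same Gram matrix are unitarily equivalent. -/
theorem exists_linearIsometryEquiv_of_inner_eq [CompleteSpace E] [CompleteSpace F] {ι : Type*}
    {b : ι → E} {a : ι → F} (h : ∀ i j, ⟪b i, b j⟫ = ⟪a i, a j⟫)
    (hb : ∀ u, (∀ i, ⟪b i, u⟫ = 0) → u = 0) (ha : ∀ u, (∀ i, ⟪a i, u⟫ = 0) → u = 0) :
    ∃ U : E ≃ₗᵢ[𝕜] F, ∀ i, U (b i) = a i := by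
  have hd1 : DenseRange (Finsupp.linearCombination 𝕜 b) := by
    have := dense_span_range_of_inner_eq_zero hb
    rwa [← Finsupp.range_linearCombination] at this
  have hd2 : DenseRange (Finsupp.linearCombination 𝕜 a) := by
    have := dense_span_range_of_inner_eq_zero ha
    rwa [← Finsupp.range_linearCombination] at this
  have hnorm : ∀ p : ι →₀ 𝕜, ‖Finsupp.linearCombination 𝕜 a (LinearEquiv.refl 𝕜 (ι →₀ 𝕜) p)‖ =
      ‖Finsupp.linearCombination 𝕜 b p‖ := fun p => by
    rw [LinearEquiv.refl_apply, @norm_eq_sqrt_re_inner 𝕜, @norm_eq_sqrt_re_inner 𝕜,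
      inner_linearCombination_eq h]
  refine ⟨(LinearEquiv.refl 𝕜 (ι →₀ 𝕜)).extendOfIsometry _ _ hd1 hd2 hnorm, fun i => ?_⟩
  have := (LinearEquiv.refl 𝕜 (ι →₀ 𝕜)).extendOfIsometry_eq _ _ hd1 hd2 hnorm (Finsupp.single i 1)
  simpa using this

end TotalFamilies

/-! ### Cyclic subspaces for a commuting pair -/

section CyclicDecomposition

variable {𝕜 : Type*} [RCLike 𝕜] {H : Type*} [NormedAddCommGroup H] [InnerProductSpace 𝕜 H]

local notation "⟪" x ", " y "⟫" => inner 𝕜 x y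

/-- Orthonormal vectors are `√2` apart, so the balls of radius `1/2` around them are disjoint and
open. -/
theorem countable_of_pairwise_inner_eq_zero [TopologicalSpace.SeparableSpace H] {M : Set H}
    (h1 : ∀ x ∈ M, ‖x‖ = 1) (h2 : ∀ x ∈ M, ∀ y ∈ M, x ≠ y → ⟪x, y⟫ = 0) : M.Countable := by
  refine Set.PairwiseDisjoint.countable_of_isOpen (s := fun x : H => Metric.ball x 2⁻¹) ?_
    (fun _ _ => Metric.isOpen_ball) (fun x _ => ⟨x, Metric.mem_ball_self (by norm_num)⟩)
  intro x hx y hy hxy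
  refine Metric.ball_disjoint_ball ?_
  rw [dist_eq_norm]
  have h := @norm_sub_sq 𝕜 _ _ _ _ x y
  rw [h2 x hx y hy hxy, h1 x hx, h1 y hy, map_zero] at h
  nlinarith [norm_nonneg (x - y)]

/-- Gram entries of orbit vectors depend only on the sums of exponents, as for moments of a measure.
-/
theorem inner_pow_mul_pow_apply {S T : H →L[𝕜] H} (hS : ∀ x y, ⟪S x, y⟫ = ⟪x, S y⟫)
    (hT : ∀ x y, ⟪T x, y⟫ = ⟪x, T y⟫) (hcomm : Commute S T) (k l k' l' : ℕ) (x y : H) :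
    ⟪(S ^ k * T ^ l) x, (S ^ k' * T ^ l') y⟫ = ⟪x, (S ^ (k + k') * T ^ (l + l')) y⟫ := by
  have hpow : ∀ R : H →L[𝕜] H, (∀ x y, ⟪R x, y⟫ = ⟪x, R y⟫) →
      ∀ (n : ℕ) (x y : H), ⟪(R ^ n) x, y⟫ = ⟪x, (R ^ n) y⟫ := by
    intro R hR n
    induction n with
    | zero => simp
    | succ n ih =>
      intro x y
      rw [pow_succ]
      change ⟪(R ^ n) (R x), y⟫ = ⟪x, (R ^ n * R) y⟫
      rw [ih, hR, ← pow_succ, pow_succ']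
      rfl
  have e : S ^ (k + k') * T ^ (l + l') = T ^ l * (S ^ k * (S ^ k' * T ^ l')) := by
    rw [(hcomm.pow_pow k l).symm.left_comm, (hcomm.pow_pow k' l).symm.left_comm, pow_add, pow_add,
      mul_assoc]
  rw [e]
  change ⟪(S ^ k) ((T ^ l) x), _⟫ = ⟪x, (T ^ l) ((S ^ k) _)⟫
  rw [hpow S hS, hpow T hT]
  rfl

/-- A separable Hilbert space is a countable orthogonal sum of cyclic subspaces for a commuting pair
of self-adjoint operators; the cyclic vectors can be chosen with square-summable norms. -/
theorem exists_cyclic_decomposition [CompleteSpace H] [TopologicalSpace.SeparableSpace H]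
    [Nontrivial H] {S T : H →L[𝕜] H} (hS : ∀ x y, ⟪S x, y⟫ = ⟪x, S y⟫)
    (hT : ∀ x y, ⟪T x, y⟫ = ⟪x, T y⟫) (hcomm : Commute S T) :
    ∃ (J : Type) (_ : Countable J) (v : J → H), HasSum (fun j => ‖v j‖ ^ 2) 1 ∧
      (∀ i j, i ≠ j → ∀ k l : ℕ, ⟪v i, (S ^ k * T ^ l) (v j)⟫ = 0) ∧
      ∀ u, (∀ j, ∀ k l : ℕ, ⟪(S ^ k * T ^ l) (v j), u⟫ = 0) → u = 0 := by
  let good : Set (Set H) := {M | (∀ x ∈ M, ‖x‖ = 1) ∧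
    ∀ x ∈ M, ∀ y ∈ M, x ≠ y → ∀ k l : ℕ, ⟪x, (S ^ k * T ^ l) y⟫ = 0}
  obtain ⟨M, hM⟩ := zorn_subset good (by
    intro c hc hchain
    refine ⟨⋃₀ c, ⟨?_, ?_⟩, fun s hs => Set.subset_sUnion_of_mem hs⟩
    · rintro x ⟨s, hs, hx⟩
      exact (hc hs).1 x hx
    · rintro x ⟨s, hs, hx⟩ y ⟨t, ht, hy⟩
      rcases hchain.total hs ht with h | h
      · exact (hc ht).2 x (h hx) y hy
      · exact (hc hs).2 x hx y (h hy))
  have hM1 := hM.prop.1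
  have hM2 := hM.prop.2
  have htot : ∀ u, (∀ x ∈ M, ∀ k l : ℕ, ⟪(S ^ k * T ^ l) x, u⟫ = 0) → u = 0 := by
    -- A nonzero `u` orthogonal to every orbit could be normalized and added to the maximal family
    -- `M`.
    intro u hu
    by_contra hu0
    let e : H := (‖u‖⁻¹ : 𝕜) • u
    have he1 : ‖e‖ = 1 := norm_smul_inv_norm hu0
    have hxe : ∀ x ∈ M, ∀ k l : ℕ, ⟪(S ^ k * T ^ l) x, e⟫ = 0 := fun x hx k l => by
      rw [inner_smul_right, hu x hx, mul_zero]
    have hmem : e ∈ M := by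
      refine hM.le_of_ge (y := insert e M) ⟨?_, ?_⟩ (Set.subset_insert e M) (Set.mem_insert e M)
      · rintro x (rfl | hx)
        exacts [he1, hM1 x hx]
      · rintro x (rfl | hx) y (rfl | hy) hxy k l
        · exact (hxy rfl).elim
        · rw [← inner_conj_symm, hxe y hy, map_zero]
        · have := inner_pow_mul_pow_apply hS hT hcomm k l 0 0 x e
          simp only [pow_zero, mul_one, add_zero, one_apply_eq_self] at this
          rw [← this, hxe x hx]
        · exact hM2 x hx y hy hxy k l
    have := hxe e hmem 0 0
    simp only [pow_zero, mul_one, one_apply_eq_self, inner_self_eq_zero] at this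
    rw [this, norm_zero] at he1
    exact zero_ne_one he1
  have hcount : Countable M := (countable_of_pairwise_inner_eq_zero hM1 fun x hx y hy hxy => by
    simpa using hM2 x hx y hy hxy 0 0).to_subtype
  have hne : Nonempty M := by
    by_contra h
    rw [not_nonempty_iff] at h
    obtain ⟨u, hu⟩ := exists_ne (0 : H)
    exact hu (htot u fun x hx => (h.false ⟨x, hx⟩).elim)
  -- A countable set has a copy in `Type`, which is where `Ω` must live.
  let J : Type := Shrink.{0} M
  let φ : M ≃ J := equivShrink.{0} M
  have : Countable J := φ.symm.injective.countable
  -- Rescaling by `√(w j / c)` gives squared norms of sum 1, hence later a probability measure.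
  obtain ⟨w, hw, c, hc, -⟩ := NNReal.exists_pos_sum_of_countable one_ne_zero J
  have hc0 : 0 < c := by
    obtain ⟨x⟩ := hne
    exact (hw (φ x)).trans_le (le_hasSum hc _ fun _ _ => zero_le)
  have hnorm : ∀ j, ‖((Real.sqrt (w j / c) : ℝ) : 𝕜) • ((φ.symm j : M) : H)‖ ^ 2 = w j / c := by
    intro j
    rw [norm_smul, hM1 _ (φ.symm j).2, mul_one, RCLike.norm_ofReal, sq_abs,
      Real.sq_sqrt (by positivity)]
  refine ⟨J, this, fun j => ((Real.sqrt (w j / c) : ℝ) : 𝕜) • ((φ.symm j : M) : H), ?_, ?_, ?_⟩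
  · simp only [hnorm]
    have := (NNReal.hasSum_coe.2 hc).div_const (c : ℝ)
    rwa [div_self (by exact_mod_cast hc0.ne')] at this
  · intro i j hij k l
    rw [map_smul, inner_smul_left, inner_smul_right, hM2 _ (φ.symm i).2 _ (φ.symm j).2, mul_zero,
      mul_zero]
    exact fun h => hij (φ.symm.injective (Subtype.ext h))
  · intro u hu
    refine htot u fun x hx k l => ?_
    have h := hu (φ ⟨x, hx⟩) k l
    rw [map_smul, inner_smul_left, Equiv.symm_apply_apply, mul_eq_zero] at h
    refine h.resolve_left ?_
    rw [RCLike.conj_ofReal]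
    have := hw (φ ⟨x, hx⟩)
    have : 0 < Real.sqrt (w (φ ⟨x, hx⟩) / c) := Real.sqrt_pos.2 (by positivity)
    exact_mod_cast this.ne'

end CyclicDecomposition

/-! ### Density of polynomials on the square -/

section MonomialDensity

open unitInterval

variable (𝕜 : Type*) [RCLike 𝕜]

/-- The monomial `s ^ k * t ^ l` as a continuous function on the unit square. -/
noncomputable def squareMonomial (k l : ℕ) : C(I × I, 𝕜) :=
  ⟨fun p => (((p.1 : ℝ) ^ k * (p.2 : ℝ) ^ l : ℝ) : 𝕜), by fun_prop⟩

theorem squareMonomial_apply (k l : ℕ) (p : I × I) :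
    squareMonomial 𝕜 k l p = (((p.1 : ℝ) ^ k * (p.2 : ℝ) ^ l : ℝ) : 𝕜) := rfl

theorem squareMonomial_mul (k l k' l' : ℕ) :
    squareMonomial 𝕜 k l * squareMonomial 𝕜 k' l' = squareMonomial 𝕜 (k + k') (l + l') := by
  ext p
  simp only [ContinuousMap.mul_apply, squareMonomial_apply]
  rw [← RCLike.ofReal_mul]
  congr 1
  ring

theorem star_squareMonomial (k l : ℕ) : star (squareMonomial 𝕜 k l) = squareMonomial 𝕜 k l := by
  ext p
  rw [ContinuousMap.star_apply, squareMonomial_apply]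
  exact RCLike.conj_ofReal _

/-- The polynomial functions on the unit square. -/
noncomputable def squarePolynomials : StarSubalgebra 𝕜 C(I × I, 𝕜) where
  __ := Submodule.toSubalgebra
    (Submodule.span 𝕜 (Set.range fun q : ℕ × ℕ => squareMonomial 𝕜 q.1 q.2))
    (Submodule.subset_span ⟨(0, 0), by ext p; simp [squareMonomial_apply]⟩)
    (fun x y hx hy => by
      have := Submodule.mul_mem_mul hx hy
      rw [Submodule.span_mul_span] at this
      refine Submodule.span_mono ?_ this
      rintro _ ⟨_, ⟨q, rfl⟩, _, ⟨r, rfl⟩, rfl⟩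
      exact ⟨q + r, (squareMonomial_mul 𝕜 _ _ _ _).symm⟩)
  star_mem' := by
    intro a ha
    change a ∈ Submodule.span 𝕜 _ at ha
    change star a ∈ Submodule.span 𝕜 _
    induction ha using Submodule.span_induction with
    | mem x hx =>
      obtain ⟨q, rfl⟩ := hx
      rw [star_squareMonomial]
      exact Submodule.subset_span ⟨q, rfl⟩
    | zero => rw [star_zero]; exact Submodule.zero_mem _
    | add x y _ _ hx hy => rw [star_add]; exact Submodule.add_mem _ hx hy
    | smul c x _ hx => rw [star_smul]; exact Submodule.smul_mem _ _ hx

theorem squarePolynomials_separatesPoints : (squarePolynomials 𝕜).SeparatesPoints := by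
  intro p q hpq
  by_contra! h
  refine hpq (Prod.ext (Subtype.ext ?_) (Subtype.ext ?_))
  · have := h _ ⟨squareMonomial 𝕜 1 0, Submodule.subset_span ⟨(1, 0), rfl⟩, rfl⟩
    simpa [squareMonomial_apply] using this
  · have := h _ ⟨squareMonomial 𝕜 0 1, Submodule.subset_span ⟨(0, 1), rfl⟩, rfl⟩
    simpa [squareMonomial_apply] using this

variable {𝕜}

/-- Stone–Weierstrass extends the orthogonality to all continuous functions, which are dense in
`L₂`. -/
theorem ae_eq_zero_of_integral_monomial_mul_eq_zero {μ : Measure (I × I)} [IsFiniteMeasure μ]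
    {f : I × I → 𝕜} (hf : MemLp f 2 μ)
    (h : ∀ k l : ℕ, ∫ p, (((p.1 : ℝ) ^ k * (p.2 : ℝ) ^ l : ℝ) : 𝕜) * f p ∂μ = 0) :
    f =ᵐ[μ] 0 := by
  have hclosed : IsClosed {g : C(I × I, 𝕜) |
      inner 𝕜 (ContinuousMap.toLp 2 μ 𝕜 g) (hf.toLp f) = 0} :=
    isClosed_eq (by fun_prop) continuous_const
  have hmem : ∀ g ∈ squarePolynomials 𝕜,
      inner 𝕜 (ContinuousMap.toLp 2 μ 𝕜 g) (hf.toLp f) = 0 := by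
    intro g hg
    change g ∈ Submodule.span 𝕜 _ at hg
    induction hg using Submodule.span_induction with
    | mem x hx =>
      obtain ⟨q, rfl⟩ := hx
      rw [L2.inner_def, ← h q.1 q.2]
      refine integral_congr_ae ?_
      filter_upwards [hf.coeFn_toLp, ContinuousMap.coeFn_toLp (p := 2) (𝕜 := 𝕜) μ
        (squareMonomial 𝕜 q.1 q.2)] with p h1 h2
      rw [h1, h2, squareMonomial_apply, RCLike.inner_apply, RCLike.conj_ofReal, mul_comm]
    | zero => simp
    | add x y _ _ hx hy => rw [map_add, inner_add_left, hx, hy, add_zero]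
    | smul c x _ hx => rw [map_smul, inner_smul_left, hx, mul_zero]
  have hall : ∀ g : C(I × I, 𝕜), inner 𝕜 (ContinuousMap.toLp 2 μ 𝕜 g) (hf.toLp f) = 0 := by
    intro g
    have htop := ContinuousMap.starSubalgebra_topologicalClosure_eq_top_of_separatesPoints _
      (squarePolynomials_separatesPoints 𝕜)
    have hg : g ∈ (squarePolynomials 𝕜).topologicalClosure := by rw [htop]; trivial
    exact closure_minimal hmem hclosed hg
  have hzero : hf.toLp f = 0 :=
    (ContinuousMap.toLp_denseRange 𝕜 μ 𝕜 (p := 2) (by simp)).eq_zero_of_inner_right 𝕜 hall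
  exact hf.coeFn_toLp.symm.trans (hzero ▸ Lp.coeFn_zero 𝕜 2 μ)

end MonomialDensity

/-! ### Disjoint unions of measures -/

section SumMeasure

variable {J X : Type*} [MeasurableSpace J] [MeasurableSingletonClass J] [MeasurableSpace X]

/-- The measure on `J × X` whose slice over `j` is `μ j`. -/
noncomputable def MeasureTheory.Measure.slices (μ : J → Measure X) : Measure (J × X) :=
  Measure.sum fun j => (μ j).map (Prod.mk j)

theorem measurableEmbedding_mk (j : J) : MeasurableEmbedding (Prod.mk j : X → J × X) :=
  MeasurableEmbedding.id.prodMk_left j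

theorem slices_restrict (μ : J → Measure X) (j : J) :
    (Measure.slices μ).restrict (Prod.fst ⁻¹' {j}) = (μ j).map (Prod.mk j) := by
  ext s hs
  have hfst : MeasurableSet (Prod.fst ⁻¹' {j} : Set (J × X)) :=
    measurable_fst (measurableSet_singleton j)
  rw [Measure.restrict_apply hs, Measure.slices, Measure.sum_apply _ (hs.inter hfst),
    tsum_eq_single j]
  · rw [(measurableEmbedding_mk j).map_apply, (measurableEmbedding_mk j).map_apply]
    congr 1
    ext x
    simp
  · intro i hij
    rw [(measurableEmbedding_mk i).map_apply]
    convert measure_empty (μ := μ i)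
    ext x
    simp [hij]

theorem ae_slices_iff [Countable J] {μ : J → Measure X} {p : J × X → Prop} :
    (∀ᵐ ω ∂Measure.slices μ, p ω) ↔ ∀ j, ∀ᵐ x ∂μ j, p (j, x) := by
  rw [Measure.slices, Measure.ae_sum_iff]
  exact forall_congr' fun j => (measurableEmbedding_mk j).ae_map_iff

theorem integral_slices_of_support {E : Type*} [NormedAddCommGroup E] [NormedSpace ℝ E]
    (μ : J → Measure X) (j : J) {f : J × X → E} (hf : ∀ i x, i ≠ j → f (i, x) = 0) :
    ∫ ω, f ω ∂Measure.slices μ = ∫ x, f (j, x) ∂μ j := by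
  rw [← (measurableEmbedding_mk j).integral_map, ← slices_restrict,
    setIntegral_eq_integral_of_forall_compl_eq_zero]
  rintro ⟨i, x⟩ hi
  exact hf i x fun h => hi h

theorem MeasureTheory.MemLp.slice {E : Type*} [NormedAddCommGroup E] {μ : J → Measure X} {p : ℝ≥0∞}
    {f : J × X → E} (hf : MemLp f p (Measure.slices μ)) (j : J) :
    MemLp (fun x => f (j, x)) p (μ j) := by
  have := hf.restrict (Prod.fst ⁻¹' {j})
  rw [slices_restrict] at this
  exact (measurableEmbedding_mk j).memLp_map_measure_iff.1 this

end SumMeasure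

/-! ### From unitaries to multiplication operators -/

section Intertwining

variable {𝕜 : Type*} [RCLike 𝕜] {H : Type*} [NormedAddCommGroup H] [InnerProductSpace 𝕜 H]
  {Ω : Type*} [MeasurableSpace Ω] {ν : Measure Ω}

/-- Both sides are tested against the total family: `S` moves onto `b i`, becomes a shift of the
index, and on the function side this is multiplication by the real `s`. The bound on `s` keeps the
product in `L₂`. -/
theorem apply_ae_eq_mul_of_total {ι : Type*} {b : ι → H} {a : ι → Lp 𝕜 2 ν} {g : ι → Ω → 𝕜}
    {U : H ≃ₗᵢ[𝕜] Lp 𝕜 2 ν} {S : H →L[𝕜] H} {s : Ω → ℝ} {shift : ι → ι} (hU : ∀ i, U (b i) = a i)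
    (hag : ∀ i, a i =ᵐ[ν] g i) (ha : ∀ u, (∀ i, inner 𝕜 (a i) u = 0) → u = 0)
    (hS : ∀ x y, inner 𝕜 (S x) y = inner 𝕜 x (S y)) (hs : Measurable s) (hs1 : ∀ ω, |s ω| ≤ 1)
    (hSb : ∀ i, S (b i) = b (shift i)) (hsg : ∀ i ω, g (shift i) ω = (s ω : 𝕜) * g i ω) (x : H) :
    U (S x) =ᵐ[ν] fun ω => (s ω : 𝕜) * U x ω := by
  have hmem : MemLp (fun ω => (s ω : 𝕜) * U x ω) 2 ν := by
    refine (Lp.memLp (U x)).mono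
      (((RCLike.measurable_ofReal.comp hs).aestronglyMeasurable).mul
        (Lp.aestronglyMeasurable (U x))) (Filter.Eventually.of_forall fun ω => ?_)
    rw [norm_mul, RCLike.norm_ofReal]
    exact mul_le_of_le_one_left (norm_nonneg _) (hs1 ω)
  have key : U (S x) = hmem.toLp _ := by
    rw [← sub_eq_zero]
    refine ha _ fun i => ?_
    rw [inner_sub_right, sub_eq_zero, ← hU, U.inner_map_map, ← hS, hSb, ← U.inner_map_map, hU, hU,
      L2.inner_def, L2.inner_def]
    refine integral_congr_ae ?_
    filter_upwards [hag i, hag (shift i), hmem.coeFn_toLp] with ω h1 h2 h3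
    rw [h1, h2, h3, hsg, RCLike.inner_apply, RCLike.inner_apply, map_mul, RCLike.conj_ofReal]
    ring
  rw [key]
  exact hmem.coeFn_toLp

end Intertwining

/-! ### Joint diagonalization of `S` and `T` -/

section JointModel

open unitInterval

variable {𝕜 : Type*} [RCLike 𝕜] {H : Type*} [NormedAddCommGroup H] [InnerProductSpace 𝕜 H]

local notation "⟪" x ", " y "⟫" => inner 𝕜 x y

/-- The joint spectral measure of a vector `v`. -/
theorem exists_spectral_measure {S T : H →L[𝕜] H}
    (hpos : ∀ (a b c d : ℕ) (x : H),
      0 ≤ RCLike.re ⟪x, (S ^ a * (1 - S) ^ b * (T ^ c * (1 - T) ^ d)) x⟫) (v : H) :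
    ∃ μ : Measure (I × I), IsFiniteMeasure μ ∧ ∀ k l : ℕ,
      ∫ p, (p.1 : ℝ) ^ k * (p.2 : ℝ) ^ l ∂μ = RCLike.re ⟪v, (S ^ k * T ^ l) v⟫ := by
  rcases eq_or_ne v 0 with rfl | hv
  · exact ⟨0, inferInstance, fun k l => by simp⟩
  have hv' : 0 < ‖v‖ ^ 2 := by positivity
  let φ : (H →L[𝕜] H) →+ ℝ :=
    { toFun := fun P => (‖v‖ ^ 2)⁻¹ * RCLike.re ⟪v, P v⟫
      map_zero' := by simp
      map_add' := fun P Q => by rw [_root_.add_apply, inner_add_right, map_add, mul_add] }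
  obtain ⟨μ, hμ⟩ := exists_measure_moments φ
    (by
      change (‖v‖ ^ 2)⁻¹ * RCLike.re ⟪v, v⟫ = 1
      rw [inner_self_eq_norm_sq, inv_mul_cancel₀ hv'.ne']) S T
    (fun a b c d => mul_nonneg (inv_nonneg.2 hv'.le) (hpos a b c d v))
  refine ⟨ENNReal.ofReal (‖v‖ ^ 2) • (μ : Measure (I × I)),
    Measure.smul_finite _ ENNReal.ofReal_ne_top, fun k l => ?_⟩
  rw [integral_smul_measure, hμ, ENNReal.toReal_ofReal hv'.le, smul_eq_mul]
  exact mul_inv_cancel_left₀ hv'.ne' _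

/-- Simultaneous diagonalization of a commuting pair of bounded self-adjoint operators whose
Bernstein products are positive. -/
theorem exists_joint_multiplication_model [CompleteSpace H] [TopologicalSpace.SeparableSpace H]
    [Nontrivial H] {S T : H →L[𝕜] H} (hS : ∀ x y, ⟪S x, y⟫ = ⟪x, S y⟫)
    (hT : ∀ x y, ⟪T x, y⟫ = ⟪x, T y⟫) (hcomm : Commute S T)
    (hpos : ∀ (a b c d : ℕ) (x : H),
      0 ≤ RCLike.re ⟪x, (S ^ a * (1 - S) ^ b * (T ^ c * (1 - T) ^ d)) x⟫) :
    ∃ (Ω : Type) (_ : MeasurableSpace Ω) (ν : Measure Ω) (_ : IsProbabilityMeasure ν)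
      (U : H ≃ₗᵢ[𝕜] Lp 𝕜 2 ν) (s t : Ω → ℝ), Measurable s ∧ Measurable t ∧
      (∀ x, U (S x) =ᵐ[ν] fun ω => (s ω : 𝕜) * U x ω) ∧
      ∀ x, U (T x) =ᵐ[ν] fun ω => (t ω : 𝕜) * U x ω := by
  classical
  obtain ⟨J, hJ, v, hsum, horth, htot⟩ := exists_cyclic_decomposition hS hT hcomm
  let _ : MeasurableSpace J := ⊤
  choose μ hfin hμ using fun j => exists_spectral_measure hpos (v j)
  let ν : Measure (J × (I × I)) := Measure.slices μ
  have hprob : IsProbabilityMeasure ν := by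
    constructor
    -- The zeroth moment gives the mass of each slice.
    have huniv : ∀ j, μ j Set.univ = ENNReal.ofReal (‖v j‖ ^ 2) := fun j => by
      have h := hμ j 0 0
      simp only [pow_zero, mul_one, integral_const, smul_eq_mul, one_apply_eq_self,
        inner_self_eq_norm_sq] at h
      rw [← h, ofReal_measureReal]
    simp only [ν, Measure.slices, Measure.sum_apply _ MeasurableSet.univ,
      (measurableEmbedding_mk _).map_apply, Set.preimage_univ, huniv]
    rw [← ENNReal.ofReal_tsum_of_nonneg (fun _ => by positivity) hsum.summable, hsum.tsum_eq,
      ENNReal.ofReal_one]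
  let g : J × ℕ × ℕ → J × (I × I) → 𝕜 := fun i ω =>
    if ω.1 = i.1 then (((ω.2.1 : ℝ) ^ i.2.1 * (ω.2.2 : ℝ) ^ i.2.2 : ℝ) : 𝕜) else 0
  have hgmeas : ∀ i, Measurable (g i) := fun i => by
    refine Measurable.ite (measurable_fst (measurableSet_singleton i.1)) ?_ measurable_const
    exact RCLike.measurable_ofReal.comp (by fun_prop)
  have hgmem : ∀ i, MemLp (g i) 2 ν := fun i => by
    refine MemLp.of_bound (hgmeas i).aestronglyMeasurable 1 (Filter.Eventually.of_forall fun ω => ?_)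
    simp only [g]
    split_ifs
    · rw [RCLike.norm_ofReal, abs_of_nonneg (mul_nonneg (pow_nonneg ω.2.1.2.1 _)
        (pow_nonneg ω.2.2.2.1 _))]
      exact mul_le_one₀ (pow_le_one₀ ω.2.1.2.1 ω.2.1.2.2) (pow_nonneg ω.2.2.2.1 _)
        (pow_le_one₀ ω.2.2.2.1 ω.2.2.2.2)
    · simp
  let a : J × ℕ × ℕ → Lp 𝕜 2 ν := fun i => (hgmem i).toLp (g i)
  have hag : ∀ i, a i =ᵐ[ν] g i := fun i => (hgmem i).coeFn_toLp
  let b : J × ℕ × ℕ → H := fun i => (S ^ i.2.1 * T ^ i.2.2) (v i.1)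
  have hgram : ∀ i j, ⟪b i, b j⟫ = ⟪a i, a j⟫ := by
    rintro ⟨i, k, l⟩ ⟨j, k', l'⟩
    have e1 : ⟪a (i, k, l), a (j, k', l')⟫ =
        ∫ ω, ⟪g (i, k, l) ω, g (j, k', l') ω⟫ ∂ν := by
      rw [L2.inner_def]
      refine integral_congr_ae ?_
      filter_upwards [hag (i, k, l), hag (j, k', l')] with ω h1 h2
      rw [h1, h2]
    have e2 : ⟪b (i, k, l), b (j, k', l')⟫ = ⟪v i, (S ^ (k + k') * T ^ (l + l')) (v j)⟫ :=
      inner_pow_mul_pow_apply hS hT hcomm k l k' l' _ _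
    rw [e1, e2, integral_slices_of_support μ i]
    · by_cases hij : i = j
      · subst hij
        -- The spectral measures record only real parts; nothing is lost, as `S ^ k T ^ l` is
        -- self-adjoint.
        have hreal : ((RCLike.re ⟪v i, (S ^ (k + k') * T ^ (l + l')) (v i)⟫ : ℝ) : 𝕜) =
            ⟪v i, (S ^ (k + k') * T ^ (l + l')) (v i)⟫ := by
          rw [← RCLike.conj_eq_iff_re, inner_conj_symm]
          simpa using inner_pow_mul_pow_apply hS hT hcomm (k + k') (l + l') 0 0 (v i) (v i)
        rw [← hreal, ← hμ i, ← integral_ofReal]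
        refine integral_congr_ae (Filter.Eventually.of_forall fun x => ?_)
        simp only [g, if_true, RCLike.inner_apply, RCLike.conj_ofReal]
        rw [← RCLike.ofReal_mul]
        congr 1
        ring
      · rw [horth i j hij]
        simp [g, hij]
    · intro i' x hi'
      simp [g, hi']
  have hb : ∀ u, (∀ i, ⟪b i, u⟫ = 0) → u = 0 := fun u hu => htot u fun j k l => hu (j, k, l)
  have ha : ∀ u, (∀ i, ⟪a i, u⟫ = 0) → u = 0 := by
    intro u hu
    refine (Lp.eq_zero_iff_ae_eq_zero).2 (ae_slices_iff.2 fun j => ?_)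
    refine ae_eq_zero_of_integral_monomial_mul_eq_zero ((Lp.memLp u).slice j) fun k l => ?_
    rw [← hu (j, k, l), L2.inner_def, ← integral_congr_ae
      (f := fun ω => ⟪g (j, k, l) ω, u ω⟫), integral_slices_of_support μ j]
    · refine integral_congr_ae (Filter.Eventually.of_forall fun x => ?_)
      simp only [g, if_true, RCLike.inner_apply, RCLike.conj_ofReal]
      rw [mul_comm]
    · intro i x hi
      simp [g, hi]
    · filter_upwards [hag (j, k, l)] with ω h
      rw [h]
  obtain ⟨U, hU⟩ := exists_linearIsometryEquiv_of_inner_eq hgram hb ha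
  refine ⟨J × (I × I), inferInstance, ν, hprob, U, fun ω => ω.2.1, fun ω => ω.2.2, by fun_prop,
    by fun_prop, ?_, ?_⟩
  · refine apply_ae_eq_mul_of_total (shift := fun i => (i.1, i.2.1 + 1, i.2.2)) hU hag ha hS
      (by fun_prop) (fun ω => abs_le.2 ⟨by linarith [ω.2.1.2.1], ω.2.1.2.2⟩) (fun i => ?_)
      fun i ω => ?_
    · simp only [b, pow_succ', mul_assoc]
      rfl
    · simp only [g]
      split_ifs
      · rw [← RCLike.ofReal_mul]; congr 1; ring
      · simp
  · refine apply_ae_eq_mul_of_total (shift := fun i => (i.1, i.2.1, i.2.2 + 1)) hU hag ha hT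
      (by fun_prop) (fun ω => abs_le.2 ⟨by linarith [ω.2.2.2.1], ω.2.2.2.2⟩) (fun i => ?_)
      fun i ω => ?_
    · simp only [b, pow_succ']
      rw [(hcomm.pow_left _).left_comm]
      rfl
    · simp only [g]
      split_ifs
      · rw [← RCLike.ofReal_mul]; congr 1; ring
      · simp

end JointModel

/-! ### The spectral theorem -/

theorem mainTheorem4 {𝕜 : Type*} [RCLike 𝕜] {H : Type*} [NormedAddCommGroup H]
    [InnerProductSpace 𝕜 H] [CompleteSpace H] [TopologicalSpace.SeparableSpace H] [Nontrivial H]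
    (A : H →ₗ.[𝕜] H) (hdense : Dense (A.domain : Set H)) (hA : IsSelfAdjoint A) :
    ∃ (Ω : Type) (_ : MeasurableSpace Ω) (μ : Measure Ω) (_ : IsProbabilityMeasure μ)
      (U : H ≃ₗᵢ[𝕜] Lp 𝕜 2 μ) (m : Ω → ℝ), Measurable m ∧
      (U.toLinearEquiv : H →ₗ[𝕜] Lp 𝕜 2 μ).compPMap A =
        (realMulOperator 𝕜 μ m).compLinear (U.toLinearEquiv : H →ₗ[𝕜] Lp 𝕜 2 μ) := by
  obtain ⟨S, B, hS, hB, hcomm, hsq, hinj, hgraph⟩ := hA.exists_bounded_pair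
  let T : H →L[𝕜] H := (2⁻¹ : 𝕜) • 1 + B
  have hT : ∀ x y, inner 𝕜 (T x) y = inner 𝕜 x (T y) := fun x y => by
    have hconj : starRingEnd 𝕜 2 = 2 := map_ofNat _ 2
    simp [T, inner_add_left, inner_add_right, inner_smul_left, inner_smul_right, hB, hconj]
  have hST : Commute S T := ((Commute.one_right S).smul_right _).add_right hcomm
  obtain ⟨Ω, _, μ, hμ, U, s, t, hs, ht, hUS, hUT⟩ := exists_joint_multiplication_model hS hT hST
    (re_inner_bernstein_nonneg hS hB hcomm hsq rfl)
  have hUB : ∀ x, U (B x) =ᵐ[μ] fun ω => ((t ω - 2⁻¹ : ℝ) : 𝕜) * U x ω := fun x => by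
    have e : U (B x) = U (T x) - (2⁻¹ : 𝕜) • U x := by
      simp [T]
    rw [e]
    filter_upwards [hUT x, Lp.coeFn_sub (U (T x)) ((2⁻¹ : 𝕜) • U x),
      Lp.coeFn_smul (2⁻¹ : 𝕜) (U x)] with ω h1 h2 h3
    rw [h2, Pi.sub_apply, h3, h1, Pi.smul_apply, smul_eq_mul]
    push_cast
    ring
  -- The indicator of `{s = 0}` is annihilated by multiplication by `s`, so injectivity of `S`
  -- forces it to vanish.
  have hs0 : ∀ᵐ ω ∂μ, s ω ≠ 0 := by
    have hmeas : MeasurableSet (s ⁻¹' {0}) := hs (measurableSet_singleton 0)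
    let f : Lp 𝕜 2 μ := indicatorConstLp 2 hmeas (measure_ne_top μ _) 1
    have hf : f =ᵐ[μ] (s ⁻¹' {0}).indicator fun _ => (1 : 𝕜) := indicatorConstLp_coeFn
    have hzero : U (S (U.symm f)) = 0 := by
      rw [Lp.eq_zero_iff_ae_eq_zero]
      filter_upwards [hUS (U.symm f), hf] with ω h1 h2
      rw [h1, U.apply_symm_apply, h2]
      by_cases h : s ω = 0 <;> simp [h]
    have hf0 : f = 0 := by
      have h := hinj _ ((LinearIsometryEquiv.map_eq_zero_iff U).1 hzero)
      rwa [LinearIsometryEquiv.map_eq_zero_iff] at h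
    filter_upwards [hf, (Lp.eq_zero_iff_ae_eq_zero).1 hf0] with ω h1 h2 h3
    rw [h2, Set.indicator_of_mem (by exact h3)] at h1
    exact zero_ne_one h1
  -- `B` acts as `t - 1/2` and `S` as `s`, so `A` must act as their quotient; the value of the
  -- division where `s = 0` is irrelevant, that set being null.
  let m : Ω → ℝ := fun ω => (t ω - 2⁻¹) / s ω
  -- The equation `B x = S y` reads `(t - 1/2) U x = s U y`. This gives both the domain and the
  -- values of `A`.
  have key : ∀ x y, (x, y) ∈ A.graph ↔ U y =ᵐ[μ] fun ω => (m ω : 𝕜) * U x ω := by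
    intro x y
    rw [hgraph, ← U.injective.eq_iff, Lp.ext_iff]
    constructor
    · intro h
      filter_upwards [h, hUB x, hUS y, hs0] with ω h h1 h2 h3
      have h3' : (s ω : 𝕜) ≠ 0 := by exact_mod_cast h3
      rw [h1, h2] at h
      simp only [m, RCLike.ofReal_div]
      rw [div_mul_eq_mul_div, h, mul_div_cancel_left₀ _ h3']
    · intro h
      filter_upwards [h, hUB x, hUS y, hs0] with ω h h1 h2 h3
      have h3' : (s ω : 𝕜) ≠ 0 := by exact_mod_cast h3
      rw [h1, h2, h]
      simp only [m, RCLike.ofReal_div]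
      rw [← mul_assoc, mul_div_cancel₀ _ h3']
  refine ⟨Ω, _, μ, hμ, U, m, by fun_prop, LinearPMap.ext ?_ ?_⟩
  · ext x
    change x ∈ A.domain ↔ MemLp (fun ω => (m ω : 𝕜) * U x ω) 2 μ
    constructor
    · intro hx
      exact (Lp.memLp _).ae_eq ((key _ _).1 (A.mem_graph ⟨x, hx⟩))
    · intro hx
      refine LinearPMap.mem_domain_of_mem_graph (y := U.symm (hx.toLp _)) ((key _ _).2 ?_)
      rw [U.apply_symm_apply]
      exact hx.coeFn_toLp
  · intro x hx hx'
    refine Lp.ext ?_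
    change MemLp (fun ω => (m ω : 𝕜) * U x ω) 2 μ at hx'
    exact ((key _ _).1 (A.mem_graph ⟨x, hx⟩)).trans hx'.coeFn_toLp.symm
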